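/- Let $n\ge 2$ be an integer and let $a_1,\dots,a_n\in\mathbb{Z}$. Consider the congruence $$a_1x_1+\dots+a_nx_n\equiv 1 \pmod n,\qquad (x_1,\dots,x_n)\in\mathbb{Z}^n. \tag{$*$}$$ 1. If $n$ is odd or some $a_i$ is even, then $(*)$ has a solution with $x_1,\dots,x_n$ pairwise distinct modulo $n$ if and only if $\gcd(a_2-a_1,a_3-a_1,\dots,a_n-a_1,n)=1$. 2. If $n\equiv 0\pmod 4$ and all $a_i$ are odd, then $(*)$ has no solution with $x_1,\dots,x_n$ pairwise distinct modulo $n$. 3. If $n\equiv 2\pmod 4$ and all $a_i$ are odd, then $(*)$ has a solution with $x_1,\dots,x_n$ pairwise distinct modulo $n$ if and only if $\gcd(a_2-a_1,a_3-a_1,\dots,a_n-a_1,n)=2$. -/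

import Mathlib

/-- The congruence `a₁x₁ + ⋯ + aₙxₙ ≡ 1 (mod n)` has an integer solution whose entries
are pairwise incongruent modulo `n`. -/
def HasDistinctSolution (n : ℕ) (a : Fin n → ℤ) : Prop :=
  ∃ x : Fin n → ℤ,
    (∑ i, a i * x i) ≡ 1 [ZMOD (n : ℤ)] ∧
    ∀ i j, i ≠ j → ¬ x i ≡ x j [ZMOD (n : ℤ)]

/-- The (non-negative) greatest common divisor `gcd(a₂ - a₁, a₃ - a₁, …, aₙ - a₁, n)`;
the first coefficient is the one of index `0 : Fin n`. -/
def differenceGcd (n : ℕ) [NeZero n] (a : Fin n → ℤ) : ℕ :=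
  Int.gcd ((Finset.univ.erase (0 : Fin n)).gcd fun i => a i - a 0) (n : ℤ)

/-! Sufficiency: multiplying distinct residues by a unit keeps them distinct, so it is enough to
make `∑ aᵢxᵢ` prime to `n` (`hasDistinctSolution_of_isCoprime`). The primes of `n` are treated in
increasing order. Exchanging the coefficients at `u` and `v` adds `(c u - c v) * (v - u)` to the
sum, so a swap with `u ≡ v` modulo the earlier primes repairs the new prime `q` without spoiling
them. `exists_perm_not_periodic` supplies such a pair after a preliminary rearrangement.

Necessity: distinct `xᵢ` run over all residues, so modulo a common divisor of `n` and the
differences the sum is `a₀ · n(n-1)/2`. This vanishes modulo odd primes; the prime 2 is settled by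
parity. -/

/-! ### Divisibility in `ZMod n` by divisors of `n`. -/

theorem natCast_dvd_intCast_iff_of_dvd {n k : ℕ} (hk : k ∣ n) (z : ℤ) :
    (k : ZMod n) ∣ (z : ZMod n) ↔ (k : ℤ) ∣ z := by
  constructor
  · rintro ⟨w, hw⟩
    obtain ⟨w, rfl⟩ := ZMod.intCast_surjective w
    have h : ((z - k * w : ℤ) : ZMod n) = 0 := by push_cast; rw [hw, sub_self]
    rw [ZMod.intCast_zmod_eq_zero_iff_dvd] at h
    have h2 : (k : ℤ) ∣ z - k * w := (Int.natCast_dvd_natCast.2 hk).trans h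
    exact (dvd_sub_left (dvd_mul_right _ _)).1 h2
  · rintro ⟨w, rfl⟩
    exact ⟨(w : ZMod n), by push_cast; rfl⟩

theorem natCast_dvd_natCast_iff_of_dvd {n k : ℕ} (hk : k ∣ n) (m : ℕ) :
    (k : ZMod n) ∣ (m : ZMod n) ↔ k ∣ m := by
  have := natCast_dvd_intCast_iff_of_dvd hk (m : ℤ)
  rw [Int.natCast_dvd_natCast] at this
  simpa using this

theorem dvd_or_dvd_of_natCast_prime_dvd_mul {n p : ℕ} (hp : p.Prime) (hpn : p ∣ n) {x y : ZMod n}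
    (h : (p : ZMod n) ∣ x * y) : (p : ZMod n) ∣ x ∨ (p : ZMod n) ∣ y := by
  obtain ⟨x, rfl⟩ := ZMod.intCast_surjective x
  obtain ⟨y, rfl⟩ := ZMod.intCast_surjective y
  rw [← Int.cast_mul] at h
  rw [natCast_dvd_intCast_iff_of_dvd hpn] at h ⊢
  rw [natCast_dvd_intCast_iff_of_dvd hpn]
  exact (Nat.prime_iff_prime_int.1 hp).dvd_or_dvd h

/-! ### Rearranging coefficients to avoid prime divisors. -/

/-- The sum `∑ c(x) x` over all residues modulo `n`. -/
def weightedSum {n : ℕ} [NeZero n] (c : ZMod n → ZMod n) : ZMod n := ∑ x, c x * x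

theorem weightedSum_comp_swap {n : ℕ} [NeZero n] (c : ZMod n → ZMod n) {u v : ZMod n}
    (huv : u ≠ v) :
    weightedSum (c ∘ Equiv.swap u v) = weightedSum c + (c u - c v) * (v - u) := by
  have h : weightedSum (c ∘ Equiv.swap u v) - weightedSum c = (c u - c v) * (v - u) := by
    unfold weightedSum
    rw [← Finset.sum_sub_distrib, Fintype.sum_eq_add u v huv]
    · simp only [Function.comp_apply, Equiv.swap_apply_left, Equiv.swap_apply_right]
      ring
    · rintro x ⟨h1, h2⟩
      simp [Equiv.swap_apply_of_ne_of_ne h1 h2]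
  rw [← h]
  ring

/-- If every `M / p` is a period of `c` modulo `q`, for `p` running over the prime factors of
the squarefree number `M`, and so is `M`, then `c` is constant modulo `q`. -/
theorem dvd_sub_of_periods {n : ℕ} {P : Finset ℕ} (hP : ∀ p ∈ P, p.Prime) (c : ZMod n → ZMod n)
    (q : ZMod n) (hM : ∀ x, q ∣ c (x + ((∏ p ∈ P, p : ℕ) : ZMod n)) - c x)
    (hD : ∀ p ∈ P, ∀ x, q ∣ c (x + ((∏ r ∈ P.erase p, r : ℕ) : ZMod n)) - c x) (x y : ZMod n) :
    q ∣ c x - c y := by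
  let H : AddSubgroup ℤ :=
    { carrier := {d | ∀ x, q ∣ c (x + (d : ZMod n)) - c x}
      zero_mem' := by intro x; simp
      add_mem' := by
        intro d e hd he x
        have h := dvd_add (he (x + d)) (hd x)
        push_cast
        rw [← add_assoc]
        simpa using h
      neg_mem' := by
        intro d hd x
        have h := (hd (x + ((-d : ℤ) : ZMod n)))
        rw [← dvd_neg]
        simpa using h }
  obtain ⟨g, hg⟩ := Int.subgroup_cyclic H
  rw [← AddSubgroup.zmultiples_eq_closure] at hg
  have mem (d : ℕ) (hd : ∀ x, q ∣ c (x + (d : ZMod n)) - c x) : g.natAbs ∣ d := by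
    have : (d : ℤ) ∈ H := by intro x; simpa using hd x
    rw [hg, Int.mem_zmultiples_iff] at this
    exact Int.natCast_dvd_natCast.1 (by simpa using this)
  -- The generator `g` of the group of periods divides `∏ P` and every `∏ P / p`, and these have no
  -- common prime factor.
  have hg1 : g.natAbs = 1 := by
    by_contra hne
    obtain ⟨r, hr, hrg⟩ := Nat.exists_prime_and_dvd hne
    obtain ⟨p, hp, hrp⟩ := (hr.prime.dvd_finsetProd_iff _).1 (hrg.trans (mem _ hM))
    obtain ⟨s, hs, hrs⟩ := (hr.prime.dvd_finsetProd_iff _).1 (hrg.trans (mem _ (hD p hp)))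
    rw [Finset.mem_erase] at hs
    have h1 := (Nat.prime_dvd_prime_iff_eq hr (hP p hp)).1 hrp
    have h2 := (Nat.prime_dvd_prime_iff_eq hr (hP s hs.2)).1 hrs
    exact hs.1 (h2.symm.trans h1)
  obtain ⟨d, hd⟩ := ZMod.intCast_surjective (x - y)
  have : d ∈ H := by
    rw [hg, Int.mem_zmultiples_iff]
    exact (Int.isUnit_iff_natAbs_eq.2 hg1).dvd
  simpa [hd] using this y

/-- The values of `c` can be rearranged so that the new function is not constant modulo `q` on some
residue class modulo `∏ P`, keeping the sum nonzero modulo every `p ∈ P`. -/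
theorem exists_perm_not_periodic {n : ℕ} [NeZero n] {P : Finset ℕ} {q : ℕ}
    (hP : ∀ p ∈ P, p.Prime) (hPn : ∀ p ∈ P, p ∣ n) (hq : q.Prime) (hqn : q ∣ n)
    (hPq : ∀ p ∈ P, p < q) (c : ZMod n → ZMod n)
    (hc : ∀ p ∈ P, ¬ (p : ZMod n) ∣ weightedSum c)
    (hcq : ∃ x y, ¬ (q : ZMod n) ∣ c x - c y) :
    ∃ τ : Equiv.Perm (ZMod n), (∀ p ∈ P, ¬ (p : ZMod n) ∣ weightedSum (c ∘ τ)) ∧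
      ∃ x y, (∀ p ∈ P, (p : ZMod n) ∣ x - y) ∧ ¬ (q : ZMod n) ∣ x - y ∧
        ¬ (q : ZMod n) ∣ c (τ x) - c (τ y) := by
  set M := ∏ p ∈ P, p with hMdef
  have hpM (p) (hp : p ∈ P) : p ∣ M := Finset.dvd_prod_of_mem _ hp
  have hpM' (p) (hp : p ∈ P) : (p : ZMod n) ∣ (M : ZMod n) := by
    rw [natCast_dvd_natCast_iff_of_dvd (hPn p hp)]; exact hpM p hp
  have hqM : ¬ q ∣ M := by
    intro h
    obtain ⟨p, hp, hqp⟩ := (hq.prime.dvd_finsetProd_iff _).1 h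
    exact absurd (Nat.le_of_dvd (hP p hp).pos hqp) (not_le.2 (hPq p hp))
  have hqM' : ¬ (q : ZMod n) ∣ (M : ZMod n) := by
    rwa [natCast_dvd_natCast_iff_of_dvd hqn]
  by_cases hper : ∀ x, (q : ZMod n) ∣ c (x + (M : ZMod n)) - c x
  swap
  · push Not at hper
    obtain ⟨x, hx⟩ := hper
    exact ⟨1, by simpa using hc, x + M, x, by simpa using hpM', by simpa using hqM',
      by simpa using hx⟩
  have hD : ∃ p ∈ P, ∃ u, ¬ (q : ZMod n) ∣ c (u + ((∏ r ∈ P.erase p, r : ℕ) : ZMod n)) - c u := by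
    by_contra! hcon
    obtain ⟨x, y, hxy⟩ := hcq
    exact hxy (dvd_sub_of_periods hP c q hper hcon x y)
  obtain ⟨p, hp, u, hu⟩ := hD
  set D := ∏ r ∈ P.erase p, r with hDdef
  have hpD : ¬ (p : ZMod n) ∣ (D : ZMod n) := by
    rw [natCast_dvd_natCast_iff_of_dvd (hPn p hp)]
    intro h
    obtain ⟨s, hs, hps⟩ := ((hP p hp).prime.dvd_finsetProd_iff _).1 h
    rw [Finset.mem_erase] at hs
    exact hs.1 ((Nat.prime_dvd_prime_iff_eq (hP p hp) (hP s hs.2)).1 hps).symm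
  have hrD (r) (hr : r ∈ P) (hrp : r ≠ p) : (r : ZMod n) ∣ (D : ZMod n) := by
    rw [natCast_dvd_natCast_iff_of_dvd (hPn r hr)]
    exact Finset.dvd_prod_of_mem _ (Finset.mem_erase.2 ⟨hrp, hr⟩)
  -- Here the order of the primes matters: `p < q` forces `q` to be odd.
  have hq2 : ¬ (q : ZMod n) ∣ 2 * (M : ZMod n) := by
    intro h
    rcases dvd_or_dvd_of_natCast_prime_dvd_mul hq hqn h with h | h
    · have h2 : q ∣ 2 := (natCast_dvd_natCast_iff_of_dvd hqn 2).1 (by simpa using h)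
      have := Nat.le_of_dvd two_pos h2
      have := hPq p hp
      have := (hP p hp).two_le
      omega
    · exact hqM' h
  have ne_of_p {x y : ZMod n} (h : ¬ (p : ZMod n) ∣ x - y) : x ≠ y := by
    rintro rfl; simp at h
  have ne_of_q {x y : ZMod n} (h : ¬ (q : ZMod n) ∣ x - y) : x ≠ y := by
    rintro rfl; simp at h
  have hMp := hpM' p hp
  have u_v : u ≠ u + D := ne_of_p (by simpa using hpD)
  have u'_v' : u + M ≠ u + M + D := ne_of_p (by simpa using hpD)
  have u_u' : u ≠ u + M := ne_of_q (by simpa using hqM')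
  have v_v' : u + D ≠ u + M + D := by simpa using u_u'
  have u_v' : u ≠ u + M + D := ne_of_p (by
    rw [show u - (u + M + D) = -(M + D) by ring, dvd_neg, dvd_add_right hMp]; exact hpD)
  have u'_v : u + M ≠ u + D := ne_of_p (by
    rw [show u + M - (u + D) = M - D by ring, dvd_sub_right hMp]; exact hpD)
  -- The point `u + 2M` is fixed by both swaps below, so it serves as a reference value congruent to
  -- `c u` modulo `q`.
  have w_u : u + 2 * M ≠ u := ne_of_q (by simpa using hq2)
  have w_u' : u + 2 * M ≠ u + M := ne_of_q (by
    rw [show u + 2 * (M : ZMod n) - (u + M) = M by ring]; exact hqM')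
  have w_v : u + 2 * M ≠ u + D := ne_of_p (by
    rw [show u + 2 * (M : ZMod n) - (u + D) = 2 * M - D by ring,
      dvd_sub_right (hMp.mul_left 2)]; exact hpD)
  have w_v' : u + 2 * M ≠ u + M + D := ne_of_p (by
    rw [show u + 2 * (M : ZMod n) - (u + M + D) = M - D by ring, dvd_sub_right hMp]; exact hpD)
  have e1 := weightedSum_comp_swap c u_v
  have e2 := weightedSum_comp_swap c u'_v'
  have e3 := weightedSum_comp_swap (c ∘ Equiv.swap u (u + (D : ZMod n))) u'_v'
  rw [Function.comp_apply, Function.comp_apply, Equiv.swap_apply_of_ne_of_ne u_u'.symm u'_v,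
    Equiv.swap_apply_of_ne_of_ne u_v'.symm v_v'.symm, Function.comp_assoc, e1] at e3
  rw [show u + (D : ZMod n) - u = D by ring] at e1 e3
  rw [show u + (M : ZMod n) + D - (u + M) = D by ring] at e2 e3
  have hw : (q : ZMod n) ∣ c (u + 2 * M) - c u := by
    have := dvd_add (hper (u + M)) (hper u)
    rw [show u + (M : ZMod n) + M = u + 2 * M by ring] at this
    simpa using this
  have hv' : (q : ZMod n) ∣ c (u + M + D) - c (u + D) := by
    have := hper (u + D)
    rwa [show u + (D : ZMod n) + M = u + M + D by ring] at this
  have good1 : ¬ (q : ZMod n) ∣ c (u + D) - c (u + 2 * M) := by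
    intro h; exact hu (by simpa using dvd_add h hw)
  have good2 : ¬ (q : ZMod n) ∣ c (u + M + D) - c (u + 2 * M) := by
    intro h; exact hu (by simpa using dvd_add (dvd_sub h hv') hw)
  -- Swapping along `D` can only affect the sum modulo `p`. Let `S₁`, `S₂`, `S₃` be the sums after
  -- the first swap, the second, and both. Then `S₁ + S₂ - S₃` is the original sum, so `p` cannot
  -- divide all three.
  by_cases h1 : (p : ZMod n) ∣ weightedSum (c ∘ Equiv.swap u (u + (D : ZMod n)))
  swap
  · refine ⟨Equiv.swap u (u + D), fun r hr => ?_, u, u + 2 * M, fun r hr => ?_, ?_, ?_⟩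
    · by_cases hrp : r = p
      · rwa [hrp]
      · rw [e1, dvd_add_left ((hrD r hr hrp).mul_left _)]; exact hc r hr
    · simpa using (hpM' r hr).mul_left 2
    · simpa using hq2
    · rw [Equiv.swap_apply_left, Equiv.swap_apply_of_ne_of_ne w_u w_v]; exact good1
  by_cases h2 : (p : ZMod n) ∣ weightedSum (c ∘ Equiv.swap (u + (M : ZMod n)) (u + M + D))
  swap
  · refine ⟨Equiv.swap (u + M) (u + M + D), fun r hr => ?_, u + M, u + 2 * M, fun r hr => ?_, ?_, ?_⟩
    · by_cases hrp : r = p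
      · rwa [hrp]
      · rw [e2, dvd_add_left ((hrD r hr hrp).mul_left _)]; exact hc r hr
    · rw [show u + (M : ZMod n) - (u + 2 * M) = -M by ring, dvd_neg]; exact hpM' r hr
    · rw [show u + (M : ZMod n) - (u + 2 * M) = -M by ring, dvd_neg]; exact hqM'
    · rw [Equiv.swap_apply_left, Equiv.swap_apply_of_ne_of_ne w_u' w_v']; exact good2
  refine ⟨Equiv.swap u (u + D) * Equiv.swap (u + M) (u + M + D), fun r hr => ?_,
    u, u + 2 * M, fun r hr => ?_, ?_, ?_⟩
  · rw [Equiv.Perm.coe_mul, e3]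
    by_cases hrp : r = p
    · subst hrp
      intro h3
      rw [e1] at h1
      rw [e2] at h2
      apply hc r hr
      have := dvd_sub (dvd_add h1 h2) h3
      ring_nf at this
      exact this
    · rw [dvd_add_left ((hrD r hr hrp).mul_left _), dvd_add_left ((hrD r hr hrp).mul_left _)]
      exact hc r hr
  · simpa using (hpM' r hr).mul_left 2
  · simpa using hq2
  · rw [Equiv.Perm.mul_apply, Equiv.Perm.mul_apply, Equiv.swap_apply_of_ne_of_ne u_u' u_v',
      Equiv.swap_apply_left, Equiv.swap_apply_of_ne_of_ne w_u' w_v',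
      Equiv.swap_apply_of_ne_of_ne w_u w_v]
    exact good1

/-- If `c` is nonconstant modulo every prime `p ∈ P`, some rearrangement of `c` has weighted sum
nonzero modulo every `p ∈ P`. -/
theorem exists_perm_weightedSum_not_dvd {n : ℕ} [NeZero n] (c : ZMod n → ZMod n) (P : Finset ℕ)
    (hP : ∀ p ∈ P, p.Prime) (hPn : ∀ p ∈ P, p ∣ n)
    (hc : ∀ p ∈ P, ∃ x y, ¬ (p : ZMod n) ∣ c x - c y) :
    ∃ τ : Equiv.Perm (ZMod n), ∀ p ∈ P, ¬ (p : ZMod n) ∣ weightedSum (c ∘ τ) := by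
  induction P using Finset.induction_on_max with
  | empty => exact ⟨1, by simp⟩
  | insert q P hlt ih =>
    simp only [Finset.forall_mem_insert] at hP hPn hc ⊢
    obtain ⟨σ, hσ⟩ := ih hP.2 hPn.2 hc.2
    have hcq : ∃ x y, ¬ (q : ZMod n) ∣ (c ∘ σ) x - (c ∘ σ) y := by
      obtain ⟨x, y, h⟩ := hc.1
      exact ⟨σ.symm x, σ.symm y, by simpa using h⟩
    obtain ⟨τ, hτ, x, y, hxyP, hxyq, hcxy⟩ :=
      exists_perm_not_periodic hP.2 hPn.2 hP.1 hPn.1 hlt (c ∘ σ) hσ hcq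
    by_cases hs : (q : ZMod n) ∣ weightedSum (c ∘ σ ∘ τ)
    swap
    · exact ⟨σ * τ, hs, hτ⟩
    have hxy : x ≠ y := by rintro rfl; simp at hxyq
    have e := weightedSum_comp_swap (c ∘ σ ∘ τ) hxy
    refine ⟨σ * τ * Equiv.swap x y, fun h => ?_, fun p hp h => ?_⟩
    · change (q : ZMod n) ∣ weightedSum ((c ∘ σ ∘ τ) ∘ Equiv.swap x y) at h
      rw [e, dvd_add_right hs] at h
      rcases dvd_or_dvd_of_natCast_prime_dvd_mul hP.1 hPn.1 h with h | h
      · exact hcxy h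
      · exact hxyq (by rwa [dvd_sub_comm])
    · change (p : ZMod n) ∣ weightedSum ((c ∘ σ ∘ τ) ∘ Equiv.swap x y) at h
      rw [e, dvd_add_left ((dvd_sub_comm.1 (hxyP p hp)).mul_left _)] at h
      exact hτ p hp h

/-! ### From rearrangements to distinct solutions. -/

theorem sum_modEq_of_pairwise_not_modEq {n : ℕ} [NeZero n] (x : Fin n → ℤ)
    (hx : ∀ i j, i ≠ j → ¬ x i ≡ x j [ZMOD (n : ℤ)]) :
    ∑ i, x i ≡ ((n * (n - 1) / 2 : ℕ) : ℤ) [ZMOD (n : ℤ)] := by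
  have hinj : Function.Injective fun i => (x i : ZMod n) := by
    intro i j hij
    by_contra hne
    exact hx i j hne ((ZMod.intCast_eq_intCast_iff _ _ _).1 hij)
  have hbij : Function.Bijective fun i => (x i : ZMod n) :=
    (Fintype.bijective_iff_injective_and_card _).2 ⟨hinj, by simp [ZMod.card]⟩
  have hinj2 : Function.Injective fun i : Fin n => ((i : ℕ) : ZMod n) := by
    intro i j hij
    have h := (ZMod.natCast_eq_natCast_iff _ _ _).1 hij
    exact Fin.ext (h.eq_of_lt_of_lt i.2 j.2)
  have hbij2 : Function.Bijective fun i : Fin n => ((i : ℕ) : ZMod n) :=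
    (Fintype.bijective_iff_injective_and_card _).2 ⟨hinj2, by simp [ZMod.card]⟩
  rw [← ZMod.intCast_eq_intCast_iff, ← Finset.sum_range_id, Finset.sum_range]
  push_cast
  rw [hbij.sum_comp (fun y : ZMod n => y), hbij2.sum_comp (fun y : ZMod n => y)]

/-- A choice of distinct residues whose weighted sum is a unit can be rescaled to a solution. -/
theorem hasDistinctSolution_of_isCoprime {n : ℕ} [NeZero n] (a x : Fin n → ℤ)
    (hx : ∀ i j, i ≠ j → ¬ x i ≡ x j [ZMOD (n : ℤ)])
    (h : IsCoprime (∑ i, a i * x i) (n : ℤ)) : HasDistinctSolution n a := by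
  obtain ⟨w, m, hw⟩ := h
  refine ⟨fun i => w * x i, ?_, fun i j hij hmod => hx i j hij ?_⟩
  · have e : ∑ i, a i * (w * x i) = w * ∑ i, a i * x i := by
      rw [Finset.mul_sum]; exact Finset.sum_congr rfl fun i _ => by ring
    rw [e, Int.modEq_iff_dvd]
    exact ⟨m, by linarith⟩
  · rw [Int.modEq_iff_dvd] at hmod ⊢
    rw [← mul_sub] at hmod
    -- The Bézout coefficient `w` is itself a unit modulo `n`.
    have hco : IsCoprime (n : ℤ) w := ⟨m, ∑ i, a i * x i, by linarith⟩
    exact hco.dvd_of_dvd_mul_left hmod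

theorem exists_distinct_not_dvd {n : ℕ} [NeZero n] (a : Fin n → ℤ) (P : Finset ℕ)
    (hP : ∀ p ∈ P, p.Prime) (hPn : ∀ p ∈ P, p ∣ n)
    (ha : ∀ p ∈ P, ∃ i j, ¬ (p : ℤ) ∣ a i - a j) :
    ∃ x : Fin n → ℤ, (∀ i j, i ≠ j → ¬ x i ≡ x j [ZMOD (n : ℤ)]) ∧
      ∀ p ∈ P, ¬ (p : ℤ) ∣ ∑ i, a i * x i := by
  obtain ⟨e⟩ : Nonempty (ZMod n ≃ Fin n) := ⟨Fintype.equivOfCardEq (by simp [ZMod.card])⟩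
  obtain ⟨τ, hτ⟩ := exists_perm_weightedSum_not_dvd (fun y => (a (e y) : ZMod n)) P hP hPn
    (fun p hp => by
      obtain ⟨i, j, hij⟩ := ha p hp
      refine ⟨e.symm i, e.symm j, ?_⟩
      simp only [Equiv.apply_symm_apply]
      rwa [← Int.cast_sub, natCast_dvd_intCast_iff_of_dvd (hPn p hp)])
  -- `x i` is the residue at which the rearrangement places the coefficient `a i`.
  refine ⟨fun i => ((τ.trans e).symm i).val, fun i j hij h => hij ?_, fun p hp h => hτ p hp ?_⟩
  · rw [← ZMod.intCast_eq_intCast_iff] at h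
    simpa using h
  · rw [← natCast_dvd_intCast_iff_of_dvd (hPn p hp)] at h
    convert h using 1
    unfold weightedSum
    rw [← (τ.trans e).sum_comp fun i => a i * _]
    push_cast
    simp

/-! ### The gcd condition and necessity. -/

theorem differenceGcd_dvd {n : ℕ} [NeZero n] (a : Fin n → ℤ) : differenceGcd n a ∣ n :=
  Int.natCast_dvd_natCast.1 (Int.gcd_dvd_right _ _)

theorem dvd_differenceGcd_iff {n : ℕ} [NeZero n] (a : Fin n → ℤ) {d : ℕ} (hd : d ∣ n) :
    d ∣ differenceGcd n a ↔ ∀ i, (d : ℤ) ∣ a i - a 0 := by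
  unfold differenceGcd
  rw [← Int.natCast_dvd_natCast, Int.dvd_coe_gcd_iff, Finset.dvd_gcd_iff]
  constructor
  · rintro ⟨h, -⟩ i
    by_cases hi : i = 0
    · simp [hi]
    · exact h i (by simp [hi])
  · exact fun h => ⟨fun i _ => h i, Int.natCast_dvd_natCast.2 hd⟩

theorem dvd_sum_sub_mul_sum {n : ℕ} [NeZero n] (a x : Fin n → ℤ) {d : ℤ}
    (h : ∀ i, d ∣ a i - a 0) : d ∣ ∑ i, a i * x i - a 0 * ∑ i, x i := by
  rw [Finset.mul_sum, ← Finset.sum_sub_distrib]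
  refine Finset.dvd_sum fun i _ => ?_
  rw [← sub_mul]
  exact (h i).mul_right _

/-- Modulo such a `p` all coefficients agree, and `∑ xᵢ ≡ n(n-1)/2` vanishes because `p` is odd and
divides `n`; the left side would then be 0 rather than 1. -/
theorem not_odd_prime_dvd_differenceGcd {n : ℕ} [NeZero n] {a : Fin n → ℤ}
    (h : HasDistinctSolution n a) {p : ℕ} (hp : p.Prime) (hp2 : p ≠ 2) :
    ¬ p ∣ differenceGcd n a := by
  intro hpg
  have hpn := hpg.trans (differenceGcd_dvd a)
  obtain ⟨x, hx1, hx⟩ := h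
  have h1 := dvd_sum_sub_mul_sum a x ((dvd_differenceGcd_iff a hpn).1 hpg)
  have hpn' : (p : ℤ) ∣ n := Int.natCast_dvd_natCast.2 hpn
  have h2 := hpn'.trans (Int.modEq_iff_dvd.1 (sum_modEq_of_pairwise_not_modEq x hx))
  have h3 := hpn'.trans (Int.modEq_iff_dvd.1 hx1)
  have h4 : p ∣ n * (n - 1) / 2 := by
    have e : n * (n - 1) / 2 * 2 = n * (n - 1) :=
      Nat.div_mul_cancel (Nat.even_mul_pred_self n).two_dvd
    have : p ∣ n * (n - 1) / 2 * 2 := by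
      rw [e]; exact hpn.mul_right _
    rcases hp.dvd_mul.1 this with h | h
    · exact h
    · exact absurd ((Nat.prime_dvd_prime_iff_eq hp Nat.prime_two).1 h) hp2
  have h5 : (p : ℤ) ∣ ∑ i, x i := by
    have := dvd_sub (Int.natCast_dvd_natCast.2 h4) h2
    simpa using this
  have h6 : (p : ℤ) ∣ 1 := by
    have := dvd_add (dvd_add h3 h1) (h5.mul_left (a 0))
    simpa using this
  exact hp.one_lt.ne' (Nat.dvd_one.1 (by exact_mod_cast h6))

/-- Odd coefficients do not affect parity, so the choice of distinct `xᵢ` is irrelevant modulo 2. -/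
theorem even_sum_mul_iff_of_odd {n : ℕ} [NeZero n] (hn : Even n) {a : Fin n → ℤ}
    (ha : ∀ i, Odd (a i)) {x : Fin n → ℤ} (hx : ∀ i j, i ≠ j → ¬ x i ≡ x j [ZMOD (n : ℤ)]) :
    (2 : ℤ) ∣ ∑ i, a i * x i ↔ 2 ∣ n * (n - 1) / 2 := by
  have hn2 : (2 : ℤ) ∣ n := by exact_mod_cast hn.two_dvd
  have h1 := hn2.trans (Int.modEq_iff_dvd.1 (sum_modEq_of_pairwise_not_modEq x hx))
  have h2 := dvd_sum_sub_mul_sum a x (fun i => ((ha i).sub_odd (ha 0)).two_dvd)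
  obtain ⟨k, hk⟩ := ha 0
  rw [hk, show (2 * k + 1) * ∑ i, x i = 2 * (k * ∑ i, x i) + ∑ i, x i by ring] at h2
  generalize k * ∑ i, x i = t at h2
  omega

theorem theorem4p2 (n : ℕ) [NeZero n] (hn : 2 ≤ n) (a : Fin n → ℤ) :
    ((Odd n ∨ ∃ i, Even (a i)) →
      (HasDistinctSolution n a ↔ differenceGcd n a = 1)) ∧
    ((n ≡ 0 [MOD 4] ∧ ∀ i, Odd (a i)) →
      ¬ HasDistinctSolution n a) ∧
    ((n ≡ 2 [MOD 4] ∧ ∀ i, Odd (a i)) →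
      (HasDistinctSolution n a ↔ differenceGcd n a = 2)) := by
  have hcop (z : ℤ) (h : ∀ p ∈ n.primeFactors, ¬ (p : ℤ) ∣ z) : IsCoprime z (n : ℤ) := by
    rw [Int.isCoprime_iff_nat_coprime, Int.natAbs_natCast]
    refine Nat.Coprime.symm (Nat.coprime_of_dvd fun p hp hpn hpz => ?_)
    exact h p (Nat.mem_primeFactors.2 ⟨hp, hpn, NeZero.ne n⟩) (Int.natCast_dvd.2 hpz)
  have hnonconst (p : ℕ) (hpn : p ∣ n) (h : ¬ p ∣ differenceGcd n a) :
      ∃ i j, ¬ (p : ℤ) ∣ a i - a j := by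
    rw [dvd_differenceGcd_iff a hpn] at h
    push Not at h
    exact ⟨h.choose, 0, h.choose_spec⟩
  refine ⟨fun hcase => ⟨fun h => ?_, fun hg => ?_⟩, ?_, ?_⟩
  · by_contra hne
    obtain ⟨p, hp, hpg⟩ := Nat.exists_prime_and_dvd hne
    by_cases hp2 : p = 2
    swap
    · exact not_odd_prime_dvd_differenceGcd h hp hp2 hpg
    subst hp2
    have hn2 := hpg.trans (differenceGcd_dvd a)
    have hd := (dvd_differenceGcd_iff a hn2).1 hpg
    have ha0 : (2 : ℤ) ∣ a 0 := by
      rcases hcase with ho | ⟨i, hi⟩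
      · exact absurd hn2 ho.not_two_dvd_nat
      · simpa using dvd_sub hi.two_dvd (hd i)
    obtain ⟨x, hx1, -⟩ := h
    have h1 := dvd_sum_sub_mul_sum a x hd
    have h3 := (Int.natCast_dvd_natCast.2 hn2).trans (Int.modEq_iff_dvd.1 hx1)
    have := ha0.mul_right (∑ i, x i)
    push_cast at h1 h3
    omega
  · obtain ⟨x, hx, hxs⟩ := exists_distinct_not_dvd a n.primeFactors
      (fun p hp => Nat.prime_of_mem_primeFactors hp) (fun p hp => Nat.dvd_of_mem_primeFactors hp)
      (fun p hp => hnonconst p (Nat.dvd_of_mem_primeFactors hp) (by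
        rw [hg, Nat.dvd_one]; exact (Nat.prime_of_mem_primeFactors hp).one_lt.ne'))
    exact hasDistinctSolution_of_isCoprime a x hx (hcop _ hxs)
  · rintro ⟨h4, ha⟩ ⟨x, hx1, hx⟩
    have hn4 : n % 4 = 0 := h4
    have hn2 : (2 : ℤ) ∣ n := by omega
    have h1 := (even_sum_mul_iff_of_odd (Nat.even_iff.2 (by omega)) ha hx).2 (by
      obtain ⟨k, rfl⟩ : 4 ∣ n := Nat.dvd_of_mod_eq_zero hn4
      rw [show 4 * k * (4 * k - 1) = 2 * (2 * (k * (4 * k - 1))) by ring,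
        Nat.mul_div_cancel_left _ two_pos]
      exact dvd_mul_right _ _)
    have h3 := hn2.trans (Int.modEq_iff_dvd.1 hx1)
    omega
  · rintro ⟨h4, ha⟩
    have hn4 : n % 4 = 2 := h4
    have hn2 : 2 ∣ n := by omega
    have h2g : 2 ∣ differenceGcd n a :=
      (dvd_differenceGcd_iff a hn2).2 fun i => ((ha i).sub_odd (ha 0)).two_dvd
    constructor
    · intro h
      obtain ⟨m, hm⟩ := h2g
      have hm1 : m = 1 := by
        by_contra hne
        obtain ⟨p, hp, hpm⟩ := Nat.exists_prime_and_dvd hne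
        by_cases hp2 : p = 2
        · subst hp2
          have : 2 * m ∣ n := hm ▸ differenceGcd_dvd a
          have : 2 * 2 ∣ n := (Nat.mul_dvd_mul_left 2 hpm).trans this
          omega
        · exact not_odd_prime_dvd_differenceGcd h hp hp2 (hm ▸ hpm.mul_left 2)
      rw [hm, hm1]
    · intro hg
      -- The prime 2 is left out because the coefficients are constant modulo 2; the sum is odd
      -- anyway, since `n(n-1)/2` is odd for `n ≡ 2 (mod 4)`.
      obtain ⟨x, hx, hxs⟩ := exists_distinct_not_dvd a (n.primeFactors.erase 2)
        (fun p hp => Nat.prime_of_mem_primeFactors (Finset.mem_of_mem_erase hp))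
        (fun p hp => Nat.dvd_of_mem_primeFactors (Finset.mem_of_mem_erase hp))
        (fun p hp => by
          rw [Finset.mem_erase] at hp
          refine hnonconst p (Nat.dvd_of_mem_primeFactors hp.2) fun h => hp.1 ?_
          rw [hg] at h
          exact (Nat.prime_dvd_prime_iff_eq (Nat.prime_of_mem_primeFactors hp.2) Nat.prime_two).1 h)
      refine hasDistinctSolution_of_isCoprime a x hx (hcop _ fun p hp => ?_)
      by_cases hp2 : p = 2
      · subst hp2
        push_cast
        rw [even_sum_mul_iff_of_odd (even_iff_two_dvd.2 hn2) ha hx]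
        obtain ⟨k, rfl⟩ : ∃ k, n = 4 * k + 2 := ⟨n / 4, by omega⟩
        rw [show (4 * k + 2) * (4 * k + 2 - 1) = 2 * (2 * (k * (4 * k + 2)) + (2 * k + 1)) by
          rw [show 4 * k + 2 - 1 = 4 * k + 1 by omega]; ring,
          Nat.mul_div_cancel_left _ two_pos]
        omega
      · exact hxs p (Finset.mem_erase.2 ⟨hp2, hp⟩)
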